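/- Write $v\wedge w=v_1w_2-v_2w_1$ for $v,w\in\mathbb R^2$. Let $\mathcal C\subset\mathbb R^2$ be a compact embedded convex curve (an arc with endpoints, or a closed loop; convex means that $\mathcal C$ lies on the boundary of its convex hull), parameterized by $c:[a,b]\to\mathcal C$ of class $C^3$ with affine unit speed, $c'\wedge c''=1$. Let $\kappa$ be its affine curvature, defined by $c'''=-\kappa c'$, and $\Lambda(\mathcal C)=\int_a^b (c'\wedge c'')^{1/3}\,ds$ its affine length. Let $\mathcal L=\{v_0+iv_1+jv_2:i,j\in\mathbb Z\}$ be a lattice, where $v_1,v_2\in\mathbb R^2$ are linearly independent, and $A_{\mathcal L}=|v_1\wedge v_2|$. Let $\mathfrak m$ be the largest positive integer such that $\mathrm{Area}(\triangle p_1p_2p_3)\ge \frac{\mathfrak m}{2}A_{\mathcal L}$ for all distinct $p_1,p_2,p_3\in\mathcal L\cap\mathcal C$ (if $\mathcal L\cap\mathcal C$ has fewer than three points, let $\mathfrak m$ be any positive integer). For $k\in\mathbb R$ let $\overline x_k,\overline y_k$ be the solutions of $u'''+ku'=0$ with $(u(0),u'(0),u''(0))=(0,1,0)$ and $(0,0,1)$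 respectively, that is, $\overline x_k(s)=\sin(\sqrt k\,s)/\sqrt k$ and $\overline y_k(s)=(1-\cos(\sqrt k\,s))/k$ for $k>0$; $\overline x_0(s)=s$ and $\overline y_0(s)=s^2/2$; $\overline x_k(s)=\sinh(\sqrt{|k|}\,s)/\sqrt{|k|}$ and $\overline y_k(s)=(1-\cosh(\sqrt{|k|}\,s))/k$ for $k<0$. The function $H_k=\overline x_k\overline y_k$ is an increasing bijection from $I_k$ onto $J_k$, where $I_k=J_k=[0,\infty)$ if $k\le 0$, and $I_k=[0,\pi/(2\sqrt k)]$, $J_k=[0,k^{-3/2}]$ if $k>0$. Let $G_k:J_k\to I_k$ be its inverse. Let $k_0,k_1$ be constants with $k_0\le\kappa\le k_1$ on $\mathcal C$. Suppose that $\mathfrak mA_{\mathcal L}/2\in J_{k_0}$, put $L=G_{k_0}(\mathfrak mA_{\mathcal L}/2)$, and if $k_1>0$ suppose that $k_1\le(\pi/(2L))^2$. Suppose also that $m=\Lambda(\mathcal C)/(2L)$ is an integer and that $\mathcal C$ is not closed, that is, not the boundary of a bounded convex domain. Then $$\#(\mathcal L\cap\mathcal C)\le 2m+1.$$ Equality holds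 if and only if $\kappa=k_0$ on all of $\mathcal C$, any two consecutive points of $\mathcal L\cap\mathcal C$ along $\mathcal C$ are at affine distance exactly $L$, and both endpoints $c(a),c(b)$ of $\mathcal C$ belong to $\mathcal L$. -/

import Mathlib

open Set Real

noncomputable section

/-- The plane. -/
abbrev Plane : Type := EuclideanSpace ℝ (Fin 2)

/-- `v ∧ w = v₁ w₂ - v₂ w₁`. -/
def wedge (v w : Plane) : ℝ := v 0 * w 1 - v 1 * w 0

/-! ### Curves, affine arc length, affine curvature -/

/-- The `n`-th derivative of the curve `c : [a, b] → ℝ²` (one-sided at the endpoints). -/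
def curveDeriv (n : ℕ) (c : ℝ → Plane) (a b : ℝ) : ℝ → Plane :=
  iteratedDerivWithin n c (Icc a b)

/-- The affine length `∫ (c' ∧ c'')^{1/3} ds` of the part of the curve `c : [a, b] → ℝ²`
between the parameters `s` and `t`. -/
def affineLength (c : ℝ → Plane) (a b s t : ℝ) : ℝ :=
  ∫ u in s..t, (wedge (curveDeriv 1 c a b u) (curveDeriv 2 c a b u)) ^ (1 / 3 : ℝ)

/-- `c : [a, b] → ℝ²` is an affine unit speed parameterization, of class `C³`, of a compact
embedded convex curve, which is either an arc or a closed loop. An embedded curve is convex if it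
lies on the boundary of its convex hull. -/
structure IsEmbeddedConvexCurve (c : ℝ → Plane) (a b : ℝ) : Prop where
  lt : a < b
  contDiffOn : ContDiffOn ℝ 3 c (Icc a b)
  unit_speed : ∀ s ∈ Icc a b, wedge (curveDeriv 1 c a b s) (curveDeriv 2 c a b s) = 1
  embedded : InjOn c (Icc a b) ∨
    (InjOn c (Ico a b) ∧ ∀ i ≤ 3, curveDeriv i c a b a = curveDeriv i c a b b)
  convex : c '' Icc a b ⊆ frontier (convexHull ℝ (c '' Icc a b))

/-- `C` is closed: it is the boundary of a bounded convex domain. -/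
def IsClosedConvexCurve (C : Set Plane) : Prop :=
  ∃ D : Set Plane, IsOpen D ∧ Convex ℝ D ∧ Bornology.IsBounded D ∧ C = frontier D

/-- The affine curvature of an affine unit speed curve. It is the unique function `κ` with
`c''' = -κ c'`; taking the wedge of this equation with `c''` gives `κ = c'' ∧ c'''`
(see `curveDeriv_three`). -/
def affineCurvature (c : ℝ → Plane) (a b s : ℝ) : ℝ :=
  wedge (curveDeriv 2 c a b s) (curveDeriv 3 c a b s)

theorem hasDerivWithinAt_curveDeriv {c : ℝ → Plane} {a b : ℝ} (hab : a < b)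
    (hc : ContDiffOn ℝ 3 c (Icc a b)) {n : ℕ} (hn : n < 3) {s : ℝ} (hs : s ∈ Icc a b) :
    HasDerivWithinAt (curveDeriv n c a b) (curveDeriv (n + 1) c a b s) (Icc a b) s := by
  have hu := uniqueDiffOn_Icc hab
  have h := hc.differentiableOn_iteratedDerivWithin (m := n) (by exact_mod_cast hn) hu
  have h2 := (h s hs).hasDerivWithinAt
  rwa [← iteratedDerivWithin_succ] at h2

/-- The defining equation `c''' = -κ c'` of the affine curvature. -/
theorem curveDeriv_three {c : ℝ → Plane} {a b : ℝ} (hC : IsEmbeddedConvexCurve c a b)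
    {s : ℝ} (hs : s ∈ Icc a b) :
    curveDeriv 3 c a b s = -(affineCurvature c a b s) • curveDeriv 1 c a b s := by
  have h1 := hasDerivWithinAt_curveDeriv hC.lt hC.contDiffOn (n := 1) (by norm_num) hs
  have h2 := hasDerivWithinAt_curveDeriv hC.lt hC.contDiffOn (n := 2) (by norm_num) hs
  have p1 (i : Fin 2) : HasDerivWithinAt (fun x => curveDeriv 1 c a b x i)
      (curveDeriv 2 c a b s i) (Icc a b) s :=
    (EuclideanSpace.proj (𝕜 := ℝ) i).hasFDerivAt.comp_hasDerivWithinAt s h1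
  have p2 (i : Fin 2) : HasDerivWithinAt (fun x => curveDeriv 2 c a b x i)
      (curveDeriv 3 c a b s i) (Icc a b) s :=
    (EuclideanSpace.proj (𝕜 := ℝ) i).hasFDerivAt.comp_hasDerivWithinAt s h2
  have h3 := ((p1 0).mul (p2 1)).sub ((p1 1).mul (p2 0))
  have h4 : HasDerivWithinAt (fun _ : ℝ => (1 : ℝ)) 0 (Icc a b) s := hasDerivWithinAt_const ..
  have h5 : HasDerivWithinAt (fun x => curveDeriv 1 c a b x 0 * curveDeriv 2 c a b x 1
      - curveDeriv 1 c a b x 1 * curveDeriv 2 c a b x 0) 0 (Icc a b) s :=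
    h4.congr (fun x hx => hC.unit_speed x hx) (hC.unit_speed s hs)
  have h6 := (uniqueDiffOn_Icc hC.lt s hs).eq_deriv _ h3 h5
  have h7 := hC.unit_speed s hs
  simp only [wedge] at h6 h7
  ext i
  fin_cases i
  · simp only [affineCurvature, wedge, Fin.zero_eta, PiLp.smul_apply, smul_eq_mul]
    linear_combination (-(curveDeriv 3 c a b s 0)) * h7 + (curveDeriv 2 c a b s 0) * h6
  · simp only [affineCurvature, wedge, Fin.mk_one, PiLp.smul_apply, smul_eq_mul]
    linear_combination (-(curveDeriv 3 c a b s 1)) * h7 + (curveDeriv 2 c a b s 1) * h6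

/-! ### Model functions of constant curvature `k` -/

/-- The solution of `u'' + k u = 0`, `u(0) = 1`, `u'(0) = 0`. -/
def cosK (k s : ℝ) : ℝ :=
  if 0 < k then cos (√k * s) else if k = 0 then 1 else cosh (√|k| * s)

/-- The solution of `u'' + k u = 0`, `u(0) = 0`, `u'(0) = 1`. -/
def sinK (k s : ℝ) : ℝ :=
  if 0 < k then sin (√k * s) / √k else if k = 0 then s else sinh (√|k| * s) / √|k|

/-- `x̄_k`. -/
def xBar (k s : ℝ) : ℝ := sinK k s

/-- `ȳ_k`. -/
def yBar (k s : ℝ) : ℝ := if k = 0 then s ^ 2 / 2 else (1 - cosK k s) / k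

/-- `H_k = x̄_k ȳ_k`. -/
def modelH (k s : ℝ) : ℝ := xBar k s * yBar k s

/-- The interval `I_k`, on which `H_k` is strictly increasing. -/
def modelI (k : ℝ) : Set ℝ := if k ≤ 0 then Ici 0 else Icc 0 (π / (2 * √k))

/-- The interval `J_k = H_k(I_k)`. -/
def modelJ (k : ℝ) : Set ℝ := if k ≤ 0 then Ici 0 else Icc 0 (1 / k ^ (3 / 2 : ℝ))

/-- `G_k : J_k → I_k`, the inverse of `H_k : I_k → J_k`. -/
def modelG (k : ℝ) : ℝ → ℝ := Function.invFunOn (modelH k) (modelI k)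

/-! ### Lattices -/

/-- The lattice with origin `v₀` generated by `v₁` and `v₂`. -/
def planeLattice (v₀ v₁ v₂ : Plane) : Set Plane :=
  {p | ∃ i j : ℤ, p = v₀ + (i : ℝ) • v₁ + (j : ℝ) • v₂}

/-- The area of a fundamental domain of the lattice generated by `v₁` and `v₂`. -/
def fundamentalArea (v₁ v₂ : Plane) : ℝ := |wedge v₁ v₂|

/-- The area of the triangle with vertices `p`, `q`, `r`. -/
def triangleArea (p q r : Plane) : ℝ := |wedge (q - p) (r - p)| / 2

/-- `n` is a positive integer such that every triangle with three distinct vertices in `S` has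
area at least `n A / 2`. -/
def IsTriangleBound (S : Set Plane) (A : ℝ) (n : ℕ) : Prop :=
  0 < n ∧ ∀ p ∈ S, ∀ q ∈ S, ∀ r ∈ S, p ≠ q → p ≠ r → q ≠ r →
    (n : ℝ) / 2 * A ≤ triangleArea p q r

/-- `n` is the largest positive integer such that every triangle with three distinct vertices
in `S` has area at least `n A / 2`. If `S` has fewer than three points then every positive integer
has this property and none is the largest; in that case any positive integer is allowed. -/
def IsTriangleIndex (S : Set Plane) (A : ℝ) (n : ℕ) : Prop :=
  IsTriangleBound S A n ∧ (3 ≤ S.encard → ∀ k, IsTriangleBound S A k → k ≤ n)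

/-- Any two consecutive points of the part of the curve `c : [a, b] → ℝ²` in `S` are at affine
distance `L` along the curve. -/
def EvenlySpaced (c : ℝ → Plane) (a b : ℝ) (S : Set Plane) (L : ℝ) : Prop :=
  ∀ s ∈ Icc a b, ∀ t ∈ Icc a b, c s ∈ S → c t ∈ S → s < t → (∀ u ∈ Ioo s t, c u ∉ S) →
    affineLength c a b s t = L

end

/-! For parameters `x < y < z`, twice the area of the inscribed triangle is the double integral of
`c'(s) ∧ c'(t)` over `s ∈ [x, y]`, `t ∈ [y, z]`. In constant curvature `k` the integrand is `sinK k
(t - s)`. Since `κ ≥ k₀`, a Sturm comparison bounds `c'(s) ∧ c'(t)` by `sinK k₀ (t - s)` as long as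
the product stays positive, and the upper curvature bound keeps it positive for `0 < t - s < 2L`
(`wedge_curveDeriv_one_pos`, `wedge_curveDeriv_one_le`). Integrating twice gives `2 * area ≤ zBar (z
- x) - zBar (y - x) - zBar (z - y)` (`triangleArea_le`). By convexity of `zBar` the right side is
largest when `y` is the midpoint, with value `2 * modelH ((z - x) / 2)`.

Lattice triangles have area at least `modelH k₀ L`, so any three lattice points on the curve span
affine length at least `2L` (`two_mul_le_of_modelH_le`). As the total length is `2Lm`, at most `2m +
1` points fit.

With `2m + 1` points every second gap is exactly `2L`, so each inequality above is an equality: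
strict convexity puts the middle points halfway, and the equality case of the Sturm comparison gives
`κ = k₀`. Conversely, even spacing from one endpoint to the other produces `2m + 1` points. A
parameterization that closes up has one point fewer at its disposal, so the bound is strict there;
the right side of the equivalence fails too, because a closed curve of constant curvature is an
ellipse (`isClosedConvexCurve_of_affineCurvature_eq`). -/

/-! ### Calculus of the model functions -/

/-- The primitive of `yBar k` that vanishes at `0`. -/
noncomputable def zBar (k s : ℝ) : ℝ := if k = 0 then s ^ 3 / 6 else (s - sinK k s) / k

theorem sinK_zero (k : ℝ) : sinK k 0 = 0 := by simp [sinK]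

theorem cosK_zero (k : ℝ) : cosK k 0 = 1 := by simp [cosK]

theorem yBar_zero (k : ℝ) : yBar k 0 = 0 := by simp [yBar, cosK_zero]

theorem zBar_zero (k : ℝ) : zBar k 0 = 0 := by simp [zBar, sinK_zero]

theorem hasDerivAt_sinK (k s : ℝ) : HasDerivAt (sinK k) (cosK k s) s := by
  unfold sinK cosK
  have hid (r : ℝ) : HasDerivAt (fun x => r * x) r s := by
    simpa using (hasDerivAt_id s).const_mul r
  rcases lt_trichotomy 0 k with h | h | h
  · simp only [h, if_true]
    have hr : √k ≠ 0 := (Real.sqrt_pos.2 h).ne'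
    refine HasDerivAt.congr_deriv ((hid √k).sin.div_const √k) ?_
    field_simp
  · subst h
    simpa using hasDerivAt_id' s
  · simp only [not_lt.2 h.le, h.ne, if_false]
    have hr : √|k| ≠ 0 := (Real.sqrt_pos.2 (abs_pos.2 h.ne)).ne'
    refine HasDerivAt.congr_deriv ((hid √|k|).sinh.div_const √|k|) ?_
    field_simp

theorem hasDerivAt_cosK (k s : ℝ) : HasDerivAt (cosK k) (-k * sinK k s) s := by
  unfold sinK cosK
  have hid (r : ℝ) : HasDerivAt (fun x => r * x) r s := by
    simpa using (hasDerivAt_id s).const_mul r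
  rcases lt_trichotomy 0 k with h | h | h
  · simp only [h, if_true]
    have hr : √k ≠ 0 := (Real.sqrt_pos.2 h).ne'
    refine HasDerivAt.congr_deriv (hid √k).cos ?_
    field_simp
    rw [Real.sq_sqrt h.le]
    ring
  · subst h
    simpa using hasDerivAt_const s (1 : ℝ)
  · simp only [not_lt.2 h.le, h.ne, if_false]
    have hr : √|k| ≠ 0 := (Real.sqrt_pos.2 (abs_pos.2 h.ne)).ne'
    refine HasDerivAt.congr_deriv (hid √|k|).cosh ?_
    field_simp
    rw [Real.sq_sqrt (abs_nonneg k), abs_of_neg h]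
    ring

theorem hasDerivAt_yBar (k s : ℝ) : HasDerivAt (yBar k) (sinK k s) s := by
  unfold yBar
  by_cases h : k = 0
  · subst h
    simp only [if_true]
    refine HasDerivAt.congr_deriv ((hasDerivAt_pow 2 s).div_const 2) ?_
    simp [sinK]
  · simp only [h, if_false]
    refine HasDerivAt.congr_deriv (((hasDerivAt_cosK k s).const_sub 1).div_const k) ?_
    field_simp

theorem hasDerivAt_zBar (k s : ℝ) : HasDerivAt (zBar k) (yBar k s) s := by
  unfold zBar yBar
  by_cases h : k = 0
  · subst h
    simp only [if_true]
    refine HasDerivAt.congr_deriv ((hasDerivAt_pow 3 s).div_const 6) ?_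
    norm_num
    ring
  · simp only [h, if_false]
    exact ((hasDerivAt_id s).sub (hasDerivAt_sinK k s)).div_const k

theorem sinK_two_mul (k s : ℝ) : sinK k (2 * s) = 2 * sinK k s * cosK k s := by
  unfold sinK cosK
  split_ifs
  · rw [show √k * (2 * s) = 2 * (√k * s) by ring, Real.sin_two_mul]; ring
  · ring
  · rw [show √|k| * (2 * s) = 2 * (√|k| * s) by ring, Real.sinh_two_mul]; ring

theorem one_sub_cosK (k s : ℝ) : 1 - cosK k s = k * yBar k s := by
  unfold yBar
  split_ifs with h
  · subst h; simp [cosK]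
  · field_simp

/-- The right side is twice the area of the model triangle with vertices at parameters `0`, `s`, `2
* s`; this identifies `modelH` as the extremal area. -/
theorem two_mul_modelH (k s : ℝ) : 2 * modelH k s = zBar k (2 * s) - 2 * zBar k s := by
  unfold modelH xBar zBar yBar
  by_cases h : k = 0
  · subst h
    simp [sinK]
    ring
  · simp only [h, if_false, sinK_two_mul]
    ring

theorem sinK_pos {k s : ℝ} (hs : 0 < s) (hk : 0 < k → s < π / √k) : 0 < sinK k s := by
  unfold sinK
  split_ifs with h h'
  · have hr := Real.sqrt_pos.2 h
    have := (lt_div_iff₀ hr).1 (hk h)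
    exact div_pos (Real.sin_pos_of_pos_of_lt_pi (by positivity) (by linarith)) hr
  · exact hs
  · have hr := Real.sqrt_pos.2 (abs_pos.2 h')
    exact div_pos (Real.sinh_pos_iff.2 (by positivity)) hr

/-- For `k > 0` the interval `modelI k` ends at a quarter period, so `2 * L` is at most the first
positive zero of `sinK k`. -/
theorem sinK_pos_of_mem_modelI {k L s : ℝ} (hL : L ∈ modelI k) (hs : 0 < s) (hsL : s < 2 * L) :
    0 < sinK k s := by
  refine sinK_pos hs fun hk => ?_
  rw [modelI, if_neg (not_le.2 hk)] at hL
  have h2 : 2 * (π / (2 * √k)) = π / √k := by ring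
  linarith [hL.2]

theorem nonneg_of_mem_modelI {k L : ℝ} (hL : L ∈ modelI k) : 0 ≤ L := by
  unfold modelI at hL
  split_ifs at hL
  · exact hL
  · exact hL.1

theorem continuous_sinK (k : ℝ) : Continuous (sinK k) :=
  continuous_iff_continuousAt.2 fun s => (hasDerivAt_sinK k s).continuousAt

theorem continuous_yBar (k : ℝ) : Continuous (yBar k) :=
  continuous_iff_continuousAt.2 fun s => (hasDerivAt_yBar k s).continuousAt

theorem continuous_zBar (k : ℝ) : Continuous (zBar k) :=
  continuous_iff_continuousAt.2 fun s => (hasDerivAt_zBar k s).continuousAt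

theorem continuous_modelH (k : ℝ) : Continuous (modelH k) :=
  (continuous_sinK k).mul (continuous_yBar k)

theorem strictMonoOn_yBar {k L : ℝ} (hL : L ∈ modelI k) :
    StrictMonoOn (yBar k) (Icc 0 (2 * L)) := by
  refine strictMonoOn_of_deriv_pos (convex_Icc _ _) (continuous_yBar k).continuousOn ?_
  intro x hx
  rw [interior_Icc] at hx
  rw [(hasDerivAt_yBar k x).deriv]
  exact sinK_pos_of_mem_modelI hL hx.1 hx.2

theorem strictConvexOn_zBar {k L : ℝ} (hL : L ∈ modelI k) :
    StrictConvexOn ℝ (Icc 0 (2 * L)) (zBar k) := by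
  refine StrictMonoOn.strictConvexOn_of_deriv (convex_Icc _ _) (continuous_zBar k).continuousOn ?_
  have : deriv (zBar k) = yBar k := funext fun s => (hasDerivAt_zBar k s).deriv
  rw [this]
  exact (strictMonoOn_yBar hL).mono interior_subset

/-- Midpoint convexity of `zBar`: among model triangles with fixed outer vertices, the one with its
middle vertex halfway in affine length is the unique largest. -/
theorem two_mul_zBar_le {k L p q : ℝ} (hL : L ∈ modelI k) (hp : 0 ≤ p) (hq : 0 ≤ q)
    (hpq : p + q ≤ 2 * L) :
    2 * zBar k ((p + q) / 2) ≤ zBar k p + zBar k q ∧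
      (2 * zBar k ((p + q) / 2) = zBar k p + zBar k q → p = q) := by
  have hcx := strictConvexOn_zBar hL
  by_cases h : p = q
  · subst h
    rw [add_self_div_two]
    exact ⟨by linarith, fun _ => rfl⟩
  · have := hcx.2 (show p ∈ Icc 0 (2 * L) from ⟨hp, by linarith⟩)
      (show q ∈ Icc 0 (2 * L) from ⟨hq, by linarith⟩) h
      (show (0 : ℝ) < 1 / 2 by norm_num) (show (0 : ℝ) < 1 / 2 by norm_num) (by norm_num)
    simp only [smul_eq_mul] at this
    rw [show 1 / 2 * p + 1 / 2 * q = (p + q) / 2 by ring] at this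
    exact ⟨by linarith, fun h' => by linarith⟩

theorem strictMonoOn_sinK {k L : ℝ} (hL : L ∈ modelI k) : StrictMonoOn (sinK k) (Icc 0 L) := by
  refine strictMonoOn_of_deriv_pos (convex_Icc _ _) (continuous_sinK k).continuousOn ?_
  intro x hx
  rw [interior_Icc] at hx
  rw [(hasDerivAt_sinK k x).deriv]
  -- The double angle formula gives `cosK k x > 0` from the positivity of `sinK` at `x` and `2 * x`,
  -- without a case split on the sign of `k`.
  have h1 : 0 < sinK k (2 * x) :=
    sinK_pos_of_mem_modelI hL (by linarith [hx.1]) (by linarith [hx.2])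
  have h2 : 0 < sinK k x := sinK_pos_of_mem_modelI hL hx.1 (by linarith [hx.1, hx.2])
  rw [sinK_two_mul] at h1
  exact (pos_iff_pos_of_mul_pos h1).1 (by linarith)

theorem strictMonoOn_modelH {k L : ℝ} (hL : L ∈ modelI k) : StrictMonoOn (modelH k) (Icc 0 L) := by
  intro x hx y hy hxy
  have hsub : ∀ z ∈ Icc 0 L, z ∈ Icc 0 (2 * L) := fun z hz => ⟨hz.1, by linarith [hz.1, hz.2]⟩
  have h0 : (0 : ℝ) ∈ Icc 0 L := ⟨le_rfl, hx.1.trans hx.2⟩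
  have h1 := strictMonoOn_sinK hL hx hy hxy
  have h2 := strictMonoOn_yBar hL (hsub x hx) (hsub y hy) hxy
  have h3 := (strictMonoOn_sinK hL).monotoneOn h0 hx hx.1
  have h4 := (strictMonoOn_yBar hL).monotoneOn (hsub 0 h0) (hsub x hx) hx.1
  rw [sinK_zero] at h3
  rw [yBar_zero] at h4
  exact mul_lt_mul'' h1 h2 h3 h4

theorem exists_modelH_eq {k v : ℝ} (hv : v ∈ modelJ k) : ∃ s ∈ modelI k, modelH k s = v := by
  have h0 : modelH k 0 = 0 := by simp [modelH, xBar, sinK_zero]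
  by_cases hk : k ≤ 0
  · rw [modelJ, if_pos hk] at hv
    rw [modelI, if_pos hk]
    obtain ⟨T, hT, hvT⟩ : ∃ T, 0 ≤ T ∧ v ≤ modelH k T := by
      -- For `k ≤ 0` the model is at least as large as the flat one, so `modelH k T ≥ T ^ 3 / 2`,
      -- which exceeds `v` at `T = 1 + 2 * v`.
      refine ⟨1 + 2 * v, by linarith [mem_Ici.1 hv], ?_⟩
      have hv' := mem_Ici.1 hv
      have hx : ∀ s, 0 ≤ s → s ≤ sinK k s := by
        intro s hs
        unfold sinK
        rw [if_neg (not_lt.2 hk)]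
        split_ifs with h
        · exact le_rfl
        · have hr := Real.sqrt_pos.2 (abs_pos.2 h)
          rw [le_div_iff₀ hr, mul_comm]
          exact Real.self_le_sinh_iff.2 (by positivity)
      have hy : ∀ s, 0 ≤ s → s ^ 2 / 2 ≤ yBar k s := by
        intro s hs
        have hm : MonotoneOn (fun s => yBar k s - s ^ 2 / 2) (Ici 0) := by
          refine monotoneOn_of_deriv_nonneg (convex_Ici _) ?_ ?_ ?_
          · exact ((continuous_yBar k).sub (by fun_prop)).continuousOn
          · exact fun x _ => ((hasDerivAt_yBar k x).sub
              ((hasDerivAt_pow 2 x).div_const 2)).differentiableAt.differentiableWithinAt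
          · intro x hx'
            rw [interior_Ici] at hx'
            have := ((hasDerivAt_yBar k x).sub ((hasDerivAt_pow 2 x).div_const 2)).deriv
            erw [this]
            have := hx x (le_of_lt hx')
            norm_num
            linarith
        have := hm (mem_Ici.2 le_rfl) (mem_Ici.2 hs) hs
        simp only [yBar_zero] at this
        linarith
      have hT : 0 ≤ 1 + 2 * v := by linarith
      have h1 := hx _ hT
      have h2 := hy _ hT
      calc v ≤ (1 + 2 * v) * ((1 + 2 * v) ^ 2 / 2) := by nlinarith [pow_nonneg hv' 3, pow_nonneg hv' 2]
        _ ≤ _ := mul_le_mul h1 h2 (by positivity) (by linarith)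
    obtain ⟨s, hs, hs'⟩ := intermediate_value_Icc hT (continuous_modelH k).continuousOn
      (show v ∈ Icc (modelH k 0) (modelH k T) from ⟨by rw [h0]; exact hv, hvT⟩)
    exact ⟨s, hs.1, hs'⟩
  · rw [modelJ, if_neg hk] at hv
    rw [modelI, if_neg hk]
    push Not at hk
    have hr := Real.sqrt_pos.2 hk
    have h1 : √k * (π / (2 * √k)) = π / 2 := by field_simp
    have h2 : modelH k (π / (2 * √k)) = 1 / k ^ (3 / 2 : ℝ) := by
      simp only [modelH, xBar, yBar, sinK, cosK, hk, hk.ne', if_true, if_false, h1,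
        Real.sin_pi_div_two, Real.cos_pi_div_two]
      rw [show (3 / 2 : ℝ) = 1 / 2 + 1 by norm_num, Real.rpow_add hk, Real.rpow_one,
        ← Real.sqrt_eq_rpow]
      field_simp
      ring
    obtain ⟨s, hs, hs'⟩ := intermediate_value_Icc (show 0 ≤ π / (2 * √k) by positivity)
      (continuous_modelH k).continuousOn (show v ∈ Icc (modelH k 0) _ by rwa [h0, h2])
    exact ⟨s, hs, hs'⟩

theorem modelG_mem {k v : ℝ} (hv : v ∈ modelJ k) : modelG k v ∈ modelI k :=
  Function.invFunOn_mem (exists_modelH_eq hv)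

theorem modelH_modelG {k v : ℝ} (hv : v ∈ modelJ k) : modelH k (modelG k v) = v :=
  Function.invFunOn_eq (exists_modelH_eq hv)

theorem modelG_pos {k v : ℝ} (hv : v ∈ modelJ k) (hpos : 0 < v) : 0 < modelG k v := by
  refine lt_of_le_of_ne (nonneg_of_mem_modelI (modelG_mem hv)) fun h => ?_
  have := modelH_modelG hv
  rw [← h, modelH, xBar, sinK_zero, zero_mul] at this
  exact hpos.ne this

/-! ### Monotonicity from one-sided derivatives -/

theorem le_of_hasDerivWithinAt_nonneg {h h' : ℝ → ℝ} {x y : ℝ} (hxy : x ≤ y)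
    (hd : ∀ t ∈ Icc x y, HasDerivWithinAt h (h' t) (Icc x y) t) (h0 : ∀ t ∈ Icc x y, 0 ≤ h' t) :
    h x ≤ h y := by
  have hm : MonotoneOn h (Icc x y) := by
    refine monotoneOn_of_hasDerivWithinAt_nonneg (convex_Icc x y)
      (fun t ht => (hd t ht).continuousWithinAt)
      (fun t ht => (hd t (interior_subset ht)).mono interior_subset)
      fun t ht => h0 t (interior_subset ht)
  exact hm (left_mem_Icc.2 hxy) (right_mem_Icc.2 hxy) hxy

/-- A monotone function with equal end values is constant. Every equality case of the comparison is
extracted this way. -/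
theorem deriv_eq_zero_of_hasDerivWithinAt_nonneg {h h' : ℝ → ℝ} {x y : ℝ} (hxy : x < y)
    (hd : ∀ t ∈ Icc x y, HasDerivWithinAt h (h' t) (Icc x y) t) (h0 : ∀ t ∈ Icc x y, 0 ≤ h' t)
    (heq : h x = h y) : ∀ t ∈ Icc x y, h' t = 0 := by
  have hle : ∀ u ∈ Icc x y, ∀ v ∈ Icc x y, u ≤ v → h u ≤ h v := by
    intro u hu v hv huv
    have hs := Icc_subset_Icc hu.1 hv.2
    exact le_of_hasDerivWithinAt_nonneg huv (fun t ht => (hd t (hs ht)).mono hs)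
      fun t ht => h0 t (hs ht)
  intro t ht
  have hc : ∀ u ∈ Icc x y, h u = h x := fun u hu =>
    le_antisymm (heq ▸ hle u hu y (right_mem_Icc.2 hxy.le) hu.2)
      (hle x (left_mem_Icc.2 hxy.le) u hu hu.1)
  have h1 : HasDerivWithinAt h 0 (Icc x y) t :=
    (hasDerivWithinAt_const t (Icc x y) (h x)).congr hc (hc t ht)
  exact (uniqueDiffOn_Icc hxy t ht).eq_deriv _ (hd t ht) h1

/-! ### The wedge product -/

theorem HasDerivWithinAt.plane_apply {u : ℝ → Plane} {u' : Plane} {S : Set ℝ} {t : ℝ}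
    (h : HasDerivWithinAt u u' S t) (i : Fin 2) : HasDerivWithinAt (fun x => u x i) (u' i) S t :=
  (EuclideanSpace.proj (𝕜 := ℝ) i).hasFDerivAt.comp_hasDerivWithinAt t h

theorem HasDerivWithinAt.wedge_left {u : ℝ → Plane} {u' : Plane} {S : Set ℝ} {t : ℝ}
    (h : HasDerivWithinAt u u' S t) (w : Plane) :
    HasDerivWithinAt (fun x => wedge (u x) w) (wedge u' w) S t :=
  ((h.plane_apply 0).mul_const (w 1)).sub ((h.plane_apply 1).mul_const (w 0))

theorem HasDerivWithinAt.wedge_right {u : ℝ → Plane} {u' : Plane} {S : Set ℝ} {t : ℝ}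
    (h : HasDerivWithinAt u u' S t) (w : Plane) :
    HasDerivWithinAt (fun x => wedge w (u x)) (wedge w u') S t :=
  ((h.plane_apply 1).const_mul (w 0)).sub ((h.plane_apply 0).const_mul (w 1))

theorem wedge_self (v : Plane) : wedge v v = 0 := by
  simp only [wedge]; ring

theorem wedge_smul_right (r : ℝ) (v w : Plane) : wedge v (r • w) = r * wedge v w := by
  simp only [wedge, PiLp.smul_apply, smul_eq_mul]; ring

theorem wedge_sub_sub (p q r : Plane) : wedge (q - p) (r - p) = wedge (q - p) (r - q) := by
  simp only [wedge, PiLp.sub_apply]; ring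

/-! ### Comparison with the model functions -/

namespace IsEmbeddedConvexCurve

variable {c : ℝ → Plane} {a b : ℝ}

theorem hasDerivWithinAt_zero (hC : IsEmbeddedConvexCurve c a b) {s : ℝ} (hs : s ∈ Icc a b) :
    HasDerivWithinAt c (curveDeriv 1 c a b s) (Icc a b) s := by
  have := hasDerivWithinAt_curveDeriv hC.lt hC.contDiffOn (n := 0) (by norm_num) hs
  have h0 : curveDeriv 0 c a b = c := by
    unfold curveDeriv
    exact iteratedDerivWithin_zero
  rwa [h0] at this

theorem hasDerivWithinAt_one (hC : IsEmbeddedConvexCurve c a b) {s : ℝ} (hs : s ∈ Icc a b) :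
    HasDerivWithinAt (curveDeriv 1 c a b) (curveDeriv 2 c a b s) (Icc a b) s :=
  hasDerivWithinAt_curveDeriv hC.lt hC.contDiffOn (n := 1) (by norm_num) hs

theorem hasDerivWithinAt_two (hC : IsEmbeddedConvexCurve c a b) {s : ℝ} (hs : s ∈ Icc a b) :
    HasDerivWithinAt (curveDeriv 2 c a b) (-(affineCurvature c a b s) • curveDeriv 1 c a b s)
      (Icc a b) s := by
  rw [← curveDeriv_three hC hs]
  exact hasDerivWithinAt_curveDeriv hC.lt hC.contDiffOn (n := 2) (by norm_num) hs

theorem continuousOn_affineCurvature (hC : IsEmbeddedConvexCurve c a b) :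
    ContinuousOn (affineCurvature c a b) (Icc a b) := by
  have h2 : ContinuousOn (curveDeriv 2 c a b) (Icc a b) := fun s hs =>
    (hC.hasDerivWithinAt_two hs).continuousWithinAt
  have h3 : ContinuousOn (curveDeriv 3 c a b) (Icc a b) :=
    hC.contDiffOn.continuousOn_iteratedDerivWithin (m := 3) le_rfl (uniqueDiffOn_Icc hC.lt)
  have p (i : Fin 2) {u : ℝ → Plane} (h : ContinuousOn u (Icc a b)) :
      ContinuousOn (fun x => u x i) (Icc a b) :=
    (EuclideanSpace.proj (𝕜 := ℝ) i).continuous.comp_continuousOn h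
  exact ((p 0 h2).mul (p 1 h3)).sub ((p 1 h2).mul (p 0 h3))

/-- Variation of constants: the derivative in `r` of the expression that joins `sinK k (t - s)`,
at `r = s`, to `c'(s) ∧ c'(t)`, at `r = t`. -/
theorem hasDerivWithinAt_variation (hC : IsEmbeddedConvexCurve c a b) (k : ℝ) (v : Plane) (t : ℝ)
    {r : ℝ} (hr : r ∈ Icc a b) :
    HasDerivWithinAt (fun r => wedge v (curveDeriv 1 c a b r) * cosK k (t - r)
        + wedge v (curveDeriv 2 c a b r) * sinK k (t - r))
      ((k - affineCurvature c a b r) * wedge v (curveDeriv 1 c a b r) * sinK k (t - r))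
      (Icc a b) r := by
  have h1 := (hC.hasDerivWithinAt_one hr).wedge_right v
  have h2 := (hC.hasDerivWithinAt_two hr).wedge_right v
  have hs : HasDerivWithinAt (fun r => t - r) (-1) (Icc a b) r :=
    (hasDerivWithinAt_id r _).const_sub t
  have h3 := (hasDerivAt_cosK k (t - r)).comp_hasDerivWithinAt r hs
  have h4 := (hasDerivAt_sinK k (t - r)).comp_hasDerivWithinAt r hs
  refine ((h1.mul h3).add (h2.mul h4)).congr_deriv ?_
  rw [wedge_smul_right]
  simp only [Function.comp]
  ring

theorem variation_left (hC : IsEmbeddedConvexCurve c a b) (k : ℝ) {s t : ℝ} (hs : s ∈ Icc a b) :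
    wedge (curveDeriv 1 c a b s) (curveDeriv 1 c a b s) * cosK k (t - s)
      + wedge (curveDeriv 1 c a b s) (curveDeriv 2 c a b s) * sinK k (t - s) = sinK k (t - s) := by
  rw [wedge_self, hC.unit_speed s hs]; ring

theorem variation_right (k : ℝ) (v : Plane) (t : ℝ) :
    wedge v (curveDeriv 1 c a b t) * cosK k (t - t)
      + wedge v (curveDeriv 2 c a b t) * sinK k (t - t) = wedge v (curveDeriv 1 c a b t) := by
  rw [sub_self, cosK_zero, sinK_zero]; ring

/-- The tangents at two points turn by less than `π` if the points are close. -/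
theorem wedge_curveDeriv_one_pos (hC : IsEmbeddedConvexCurve c a b) {M K : ℝ}
    (hM : M ∈ modelI K) (hκ : ∀ s ∈ Icc a b, affineCurvature c a b s ≤ K)
    {s t : ℝ} (hs : s ∈ Icc a b) (ht : t ∈ Icc a b) (hst : s < t) (htM : t - s < 2 * M) :
    0 < wedge (curveDeriv 1 c a b s) (curveDeriv 1 c a b t) := by
  by_contra! hneg
  set v := curveDeriv 1 c a b s with hv
  set f : ℝ → ℝ := fun r => wedge v (curveDeriv 1 c a b r) with hf
  have hsub : Icc s t ⊆ Icc a b := Icc_subset_Icc hs.1 ht.2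
  have hd : ∀ r ∈ Icc a b, HasDerivWithinAt f (wedge v (curveDeriv 2 c a b r)) (Icc a b) r :=
    fun r hr => (hC.hasDerivWithinAt_one hr).wedge_right v
  have hcont : ContinuousOn f (Icc s t) := fun r hr =>
    ((hd r (hsub hr)).continuousWithinAt).mono hsub
  -- `f` vanishes at `s` with derivative `c' ∧ c'' = 1`.
  have hnear : ∃ ε > s, ε < t ∧ ∀ r ∈ Ioo s ε, 0 < f r := by
    have h1 : HasDerivWithinAt f 1 (Ioi s) s := by
      have := hd s hs
      rw [hv, hC.unit_speed s hs] at this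
      have h2 := (this.mono hsub).mono_of_mem_nhdsWithin (Icc_mem_nhdsGT hst)
      exact h2
    rw [hasDerivWithinAt_iff_tendsto_slope' (by simp)] at h1
    have h2 := h1.eventually (lt_mem_nhds (show (0 : ℝ) < 1 by norm_num))
    obtain ⟨u, hu, hu'⟩ := (mem_nhdsGT_iff_exists_Ioo_subset' (show t ∈ Ioi s from hst)).1 h2
    refine ⟨min u ((s + t) / 2), lt_min hu (by linarith), (min_le_right _ _).trans_lt (by linarith),
      fun r hr => ?_⟩
    have h3 : 0 < slope f s r := hu' ⟨hr.1, hr.2.trans_le (min_le_left _ _)⟩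
    have h4 : f s = 0 := wedge_self _
    rw [slope_def_field, h4, sub_zero] at h3
    exact (div_pos_iff_of_pos_right (by linarith [hr.1])).1 h3
  obtain ⟨ε, hsε, hεt, hε⟩ := hnear
  set e := (s + ε) / 2 with he
  have hse : s < e := by rw [he]; linarith
  have hee : e < ε := by rw [he]; linarith
  -- Starting at `e > s` excludes the trivial zero of `f` at `s`, so the least element is the first
  -- later parameter at which `f` fails to be positive.
  have hZ : IsCompact (Icc e t ∩ f ⁻¹' Iic 0) := by
    refine IsCompact.of_isClosed_subset isCompact_Icc ?_ inter_subset_left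
    exact (hcont.mono (Icc_subset_Icc hse.le le_rfl)).preimage_isClosed_of_isClosed
      isClosed_Icc isClosed_Iic
  obtain ⟨t₀, ⟨ht₀, hft₀⟩, hleast⟩ := hZ.exists_isLeast ⟨t, ⟨by linarith, le_rfl⟩, hneg⟩
  have hft₀' : f t₀ ≤ 0 := hft₀
  have hst₀ : s < t₀ := hse.trans_le ht₀.1
  have hsub' : Icc s t₀ ⊆ Icc a b := (Icc_subset_Icc le_rfl ht₀.2).trans hsub
  have hpos : ∀ r ∈ Ioo s t₀, 0 < f r := by
    intro r hr
    by_cases hrε : r < ε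
    · exact hε r ⟨hr.1, hrε⟩
    · by_contra! hle
      exact absurd (hleast ⟨⟨by linarith, hr.2.le.trans ht₀.2⟩, hle⟩) (not_le.2 hr.2)
  -- Before `t₀` both `f` and `sinK K (t₀ - ·)` are positive and `κ ≤ K`, so the variation
  -- expression increases. This forces `f t₀ > 0`, a contradiction.
  have hvar : sinK K (t₀ - s) ≤ f t₀ := by
    have := le_of_hasDerivWithinAt_nonneg hst₀.le
      (fun r hr => (hC.hasDerivWithinAt_variation K v t₀ (hsub' hr)).mono hsub') ?_
    · rwa [hC.variation_left K hs, variation_right] at this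
    · intro r hr
      rcases hr.1.eq_or_lt with h | h
      · subst h; rw [hv, wedge_self]; simp
      rcases hr.2.eq_or_lt with h' | h'
      · subst h'; simp [sinK_zero]
      have h3 := sinK_pos_of_mem_modelI hM (s := t₀ - r) (by linarith) (by linarith [ht₀.2])
      exact mul_nonneg (mul_nonneg (sub_nonneg.2 (hκ r (hsub' hr))) (hpos r ⟨h, h'⟩).le) h3.le
  have := sinK_pos_of_mem_modelI hM (s := t₀ - s) (by linarith) (by linarith [ht₀.2])
  linarith

variable {k L K : ℝ}

/-- Upper comparison for the wedge product of two tangents, with its case of equality. -/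
theorem wedge_curveDeriv_one_le (hC : IsEmbeddedConvexCurve c a b) (hL : L ∈ modelI k)
    (hK : L ∈ modelI K)
    (hκ : ∀ s ∈ Icc a b, k ≤ affineCurvature c a b s ∧ affineCurvature c a b s ≤ K)
    {s t : ℝ} (hs : s ∈ Icc a b) (ht : t ∈ Icc a b) (hst : s ≤ t) (htL : t - s ≤ 2 * L) :
    wedge (curveDeriv 1 c a b s) (curveDeriv 1 c a b t) ≤ sinK k (t - s) ∧
      (s < t → wedge (curveDeriv 1 c a b s) (curveDeriv 1 c a b t) = sinK k (t - s) →
        ∀ r ∈ Icc s t, affineCurvature c a b r = k) := by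
  set v := curveDeriv 1 c a b s with hv
  have hsub : Icc s t ⊆ Icc a b := Icc_subset_Icc hs.1 ht.2
  have hpos : ∀ r ∈ Ioo s t, 0 < wedge v (curveDeriv 1 c a b r) ∧ 0 < sinK k (t - r) :=
    fun r hr => ⟨hC.wedge_curveDeriv_one_pos hK (fun u hu => (hκ u hu).2) hs
      (hsub (Ioo_subset_Icc_self hr)) hr.1 (by linarith [hr.2]),
      sinK_pos_of_mem_modelI hL (by linarith [hr.2]) (by linarith [hr.1])⟩
  have hd : ∀ r ∈ Icc s t, _ := fun r hr =>
    ((hC.hasDerivWithinAt_variation k v t (hsub hr)).mono hsub).neg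
  have h0 : ∀ r ∈ Icc s t, 0 ≤ -((k - affineCurvature c a b r) * wedge v (curveDeriv 1 c a b r)
      * sinK k (t - r)) := by
    intro r hr
    rcases hr.1.eq_or_lt with h | h
    · subst h; rw [hv, wedge_self]; simp
    rcases hr.2.eq_or_lt with h' | h'
    · subst h'; simp [sinK_zero]
    obtain ⟨h1, h2⟩ := hpos r ⟨h, h'⟩
    have h3 := mul_nonneg (mul_nonneg (sub_nonneg.2 (hκ r (hsub hr)).1) h1.le) h2.le
    linarith
  refine ⟨?_, fun hlt heq => ?_⟩
  · have := le_of_hasDerivWithinAt_nonneg hst hd h0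
    simp only [Pi.neg_apply] at this
    rw [hC.variation_left k hs, variation_right] at this
    linarith
  · have h1 := deriv_eq_zero_of_hasDerivWithinAt_nonneg hlt hd h0 (by
      simp only [Pi.neg_apply]
      rw [hC.variation_left k hs, variation_right, heq])
    -- Inside the interval the other two factors of the vanishing derivative are positive, so `κ =
    -- k` there; continuity extends this to the endpoints.
    have h2 : EqOn (affineCurvature c a b) (fun _ => k) (Ioo s t) := by
      intro r hr
      obtain ⟨h3, h4⟩ := hpos r hr
      have := h1 r (Ioo_subset_Icc_self hr)
      rw [neg_eq_zero, mul_eq_zero, mul_eq_zero] at this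
      rcases this with (h | h) | h
      · show _ = k
        linarith
      · exact absurd h h3.ne'
      · exact absurd h h4.ne'
    have h3 := h2.of_subset_closure (hC.continuousOn_affineCurvature.mono hsub)
      continuousOn_const Ioo_subset_Icc_self (by rw [closure_Ioo hlt.ne])
    exact fun r hr => h3 hr

/-- Upper comparison for the wedge product of a tangent and a chord, with its case of equality. -/
theorem wedge_curveDeriv_one_sub_le (hC : IsEmbeddedConvexCurve c a b) (hL : L ∈ modelI k)
    (hK : L ∈ modelI K)
    (hκ : ∀ s ∈ Icc a b, k ≤ affineCurvature c a b s ∧ affineCurvature c a b s ≤ K)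
    {s x y : ℝ} (hs : s ∈ Icc a b) (hy : y ∈ Icc a b) (hsx : s ≤ x) (hxy : x < y)
    (hyL : y - s ≤ 2 * L) :
    wedge (curveDeriv 1 c a b s) (c y - c x) ≤ yBar k (y - s) - yBar k (x - s) ∧
      (wedge (curveDeriv 1 c a b s) (c y - c x) = yBar k (y - s) - yBar k (x - s) →
        ∀ r ∈ Icc s y, affineCurvature c a b r = k) := by
  set v := curveDeriv 1 c a b s with hv
  have hsub : Icc x y ⊆ Icc a b := Icc_subset_Icc (hs.1.trans hsx) hy.2
  have hd : ∀ t ∈ Icc x y, HasDerivWithinAt (fun t => yBar k (t - s) - wedge v (c t))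
      (sinK k (t - s) - wedge v (curveDeriv 1 c a b t)) (Icc x y) t := by
    intro t ht
    have h1 : HasDerivWithinAt (fun t => t - s) 1 (Icc x y) t :=
      (hasDerivWithinAt_id t _).sub_const s
    have h2 := (hasDerivAt_yBar k (t - s)).comp_hasDerivWithinAt t h1
    rw [mul_one] at h2
    exact h2.sub (((hC.hasDerivWithinAt_zero (hsub ht)).mono hsub).wedge_right v)
  have hcmp := fun t (ht : t ∈ Icc x y) => hC.wedge_curveDeriv_one_le hL hK hκ hs (hsub ht)
    (hsx.trans ht.1) (by linarith [ht.2])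
  have h0 : ∀ t ∈ Icc x y, 0 ≤ sinK k (t - s) - wedge v (curveDeriv 1 c a b t) :=
    fun t ht => sub_nonneg.2 (hcmp t ht).1
  have hw : wedge v (c y - c x) = wedge v (c y) - wedge v (c x) := by
    simp only [wedge, PiLp.sub_apply]; ring
  rw [hw]
  refine ⟨?_, fun heq => ?_⟩
  · have := le_of_hasDerivWithinAt_nonneg hxy.le hd h0
    linarith
  -- Equality of the tangents at the far end `y` alone already controls the curvature on all of `[s,
  -- y]`.
  · have := deriv_eq_zero_of_hasDerivWithinAt_nonneg hxy hd h0 (by linarith) y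
      (right_mem_Icc.2 hxy.le)
    exact (hcmp y (right_mem_Icc.2 hxy.le)).2 (hsx.trans_lt hxy) (by linarith)

/-- Integrates the positivity of `c'(s) ∧ c'(t)`. It fixes the orientation of inscribed triangles,
which removes the absolute value from their area, and later shows that curves with `κ ≤ 0` cannot
close up. -/
theorem wedge_curveDeriv_one_sub_pos (hC : IsEmbeddedConvexCurve c a b)
    (hK : L ∈ modelI K) (hκ : ∀ s ∈ Icc a b, affineCurvature c a b s ≤ K)
    {s x y : ℝ} (hs : s ∈ Icc a b) (hy : y ∈ Icc a b) (hsx : s ≤ x) (hxy : x < y)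
    (hyL : y - s ≤ 2 * L) :
    0 < wedge (curveDeriv 1 c a b s) (c y - c x) := by
  set v := curveDeriv 1 c a b s with hv
  have hsub : Icc x y ⊆ Icc a b := Icc_subset_Icc (hs.1.trans hsx) hy.2
  have hd : ∀ t ∈ Icc x y, HasDerivWithinAt (fun t => wedge v (c t))
      (wedge v (curveDeriv 1 c a b t)) (Icc a b) t :=
    fun t ht => (hC.hasDerivWithinAt_zero (hsub ht)).wedge_right v
  have hm : StrictMonoOn (fun t => wedge v (c t)) (Icc x y) := by
    refine strictMonoOn_of_hasDerivWithinAt_pos (f' := fun t => wedge v (curveDeriv 1 c a b t))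
      (convex_Icc x y)
      (fun t ht => (hd t ht).continuousWithinAt.mono hsub) (fun t ht => ?_) fun t ht => ?_
    · exact (hd t (interior_subset ht)).mono (interior_subset.trans hsub)
    · rw [interior_Icc] at ht
      exact hC.wedge_curveDeriv_one_pos hK hκ hs (hsub (Ioo_subset_Icc_self ht))
        (hsx.trans_lt ht.1) (by linarith [ht.2])
  have := hm (left_mem_Icc.2 hxy.le) (right_mem_Icc.2 hxy.le) hxy
  have hw : wedge v (c y - c x) = wedge v (c y) - wedge v (c x) := by
    simp only [wedge, PiLp.sub_apply]; ring
  rw [hw]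
  simp only at this
  linarith

/-- Upper comparison for the area of a triangle inscribed in the curve, with its case of
equality. -/
theorem triangleArea_le (hC : IsEmbeddedConvexCurve c a b) (hL : L ∈ modelI k)
    (hK : L ∈ modelI K)
    (hκ : ∀ s ∈ Icc a b, k ≤ affineCurvature c a b s ∧ affineCurvature c a b s ≤ K)
    {x y z : ℝ} (hx : x ∈ Icc a b) (hz : z ∈ Icc a b) (hxy : x < y) (hyz : y < z)
    (hzL : z - x ≤ 2 * L) :
    2 * triangleArea (c x) (c y) (c z) ≤ zBar k (z - x) - zBar k (y - x) - zBar k (z - y) ∧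
      (2 * triangleArea (c x) (c y) (c z) = zBar k (z - x) - zBar k (y - x) - zBar k (z - y) →
        ∀ r ∈ Icc x z, affineCurvature c a b r = k) := by
  set w := c z - c y with hw
  have hsub : Icc x y ⊆ Icc a b := Icc_subset_Icc hx.1 (hyz.le.trans hz.2)
  have hd0 : ∀ s ∈ Icc x y, HasDerivWithinAt (fun s => wedge (c s) w)
      (wedge (curveDeriv 1 c a b s) w) (Icc x y) s := fun s hs =>
    ((hC.hasDerivWithinAt_zero (hsub hs)).mono hsub).wedge_left w
  have hpos : 0 ≤ wedge (c y - c x) w := by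
    have := le_of_hasDerivWithinAt_nonneg hxy.le hd0 fun s hs =>
      (hC.wedge_curveDeriv_one_sub_pos hK (fun u hu => (hκ u hu).2) (hsub hs) hz hs.2 hyz
        (by linarith [hs.1])).le
    simp only [wedge, PiLp.sub_apply] at this ⊢
    linarith
  have harea : 2 * triangleArea (c x) (c y) (c z) = wedge (c y) w - wedge (c x) w := by
    rw [triangleArea, wedge_sub_sub, abs_of_nonneg hpos]
    simp only [wedge, PiLp.sub_apply]; ring
  have hd : ∀ s ∈ Icc x y, HasDerivWithinAt
      (fun s => zBar k (y - s) - zBar k (z - s) - wedge (c s) w)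
      (yBar k (z - s) - yBar k (y - s) - wedge (curveDeriv 1 c a b s) w) (Icc x y) s := by
    intro s hs
    have h1 (u : ℝ) : HasDerivWithinAt (fun s => u - s) (-1) (Icc x y) s :=
      (hasDerivWithinAt_id s _).const_sub u
    have h2 (u : ℝ) := (hasDerivAt_zBar k (u - s)).comp_hasDerivWithinAt s (h1 u)
    refine (((h2 y).sub (h2 z)).sub (hd0 s hs)).congr_deriv ?_
    ring
  have hcmp := fun s (hs : s ∈ Icc x y) => hC.wedge_curveDeriv_one_sub_le hL hK hκ (hsub hs) hz
    hs.2 hyz (by linarith [hs.1])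
  have h0 : ∀ s ∈ Icc x y,
      0 ≤ yBar k (z - s) - yBar k (y - s) - wedge (curveDeriv 1 c a b s) w :=
    fun s hs => sub_nonneg.2 (hcmp s hs).1
  rw [harea]
  refine ⟨?_, fun heq => ?_⟩
  · have := le_of_hasDerivWithinAt_nonneg hxy.le hd h0
    simp only [sub_self, zBar_zero] at this
    linarith
  · have := deriv_eq_zero_of_hasDerivWithinAt_nonneg hxy hd h0
      (by simp only [sub_self, zBar_zero]; linarith) x (left_mem_Icc.2 hxy.le)
    exact (hcmp x (left_mem_Icc.2 hxy.le)).2 (by linarith)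

/-- A triangle of area at least `modelH k L` inscribed in the curve spans an affine length of at
least `2 * L`. -/
theorem two_mul_le_of_modelH_le (hC : IsEmbeddedConvexCurve c a b) (hL : L ∈ modelI k)
    (hK : L ∈ modelI K)
    (hκ : ∀ s ∈ Icc a b, k ≤ affineCurvature c a b s ∧ affineCurvature c a b s ≤ K)
    {x y z : ℝ} (hx : x ∈ Icc a b) (hz : z ∈ Icc a b) (hxy : x < y) (hyz : y < z)
    (hA : modelH k L ≤ triangleArea (c x) (c y) (c z)) :
    2 * L ≤ z - x ∧ (z - x = 2 * L → y = x + L ∧ ∀ r ∈ Icc x z, affineCurvature c a b r = k) := by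
  -- The comparison is available only for spans up to `2 * L`. There it gives `modelH k L ≤ area ≤
  -- modelH k ((z - x) / 2) ≤ modelH k L`, so every inequality in the chain is an equality.
  have hmain : z - x ≤ 2 * L →
      z - x = 2 * L ∧ y = x + L ∧ ∀ r ∈ Icc x z, affineCurvature c a b r = k := by
    intro hzL
    obtain ⟨h1, h1'⟩ := hC.triangleArea_le hL hK hκ hx hz hxy hyz hzL
    obtain ⟨h2, h2'⟩ := two_mul_zBar_le hL (p := y - x) (q := z - y) (by linarith) (by linarith)
      (by linarith)
    have e : y - x + (z - y) = z - x := by ring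
    rw [e] at h2 h2'
    have h3 := two_mul_modelH k ((z - x) / 2)
    rw [show 2 * ((z - x) / 2) = z - x by ring] at h3
    have hm := strictMonoOn_modelH hL
    have hL0 := nonneg_of_mem_modelI hL
    have m1 : (z - x) / 2 ∈ Icc 0 L := ⟨by linarith, by linarith⟩
    have m2 : L ∈ Icc 0 L := ⟨hL0, le_rfl⟩
    have h4 := hm.monotoneOn m1 m2 m1.2
    have h5 : (z - x) / 2 = L := hm.injOn m1 m2 (by linarith)
    have h6 := h2' (by linarith)
    exact ⟨by linarith, by linarith, h1' (by linarith)⟩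
  refine ⟨?_, fun h => (hmain h.le).2⟩
  by_contra! h
  linarith [(hmain h.le).1]

end IsEmbeddedConvexCurve

/-! ### Counting points with prescribed gaps -/

theorem exists_strictMonoOn_of_le_encard {T : Set ℝ} {n : ℕ} (h : (n : ℕ∞) ≤ T.encard) :
    ∃ g : ℕ → ℝ, (∀ i < n, g i ∈ T) ∧ StrictMonoOn g (Iio n) := by
  obtain ⟨F, hF, hFn⟩ := exists_subset_encard_eq h
  have hfin : F.Finite := finite_of_encard_eq_coe hFn
  have hcard : hfin.toFinset.card = n := by
    rw [hfin.encard_eq_coe_toFinset_card] at hFn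
    exact_mod_cast hFn
  refine ⟨fun i => if hi : i < n then hfin.toFinset.orderEmbOfFin hcard ⟨i, hi⟩ else 0,
    fun i hi => ?_, fun i hi j hj hij => ?_⟩
  · simp only [hi, dif_pos]
    exact hF (hfin.mem_toFinset.1 (Finset.orderEmbOfFin_mem _ hcard _))
  · simp only [mem_Iio.1 hi, mem_Iio.1 hj, dif_pos]
    exact (hfin.toFinset.orderEmbOfFin hcard).strictMono hij

section Gap

variable {T : Set ℝ} {a b L : ℝ} {m n : ℕ}

theorem add_two_mul_le_of_gap (hgap : ∀ x ∈ T, ∀ y ∈ T, ∀ z ∈ T, x < y → y < z → 2 * L ≤ z - x)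
    {g : ℕ → ℝ} (hg : ∀ i < n, g i ∈ T) (hmono : StrictMonoOn g (Iio n)) (i j : ℕ)
    (h : i + 2 * j < n) : g i + 2 * L * j ≤ g (i + 2 * j) := by
  induction j with
  | zero => simp
  | succ j ih =>
    have h1 := ih (by omega)
    have h2 := hgap (g (i + 2 * j)) (hg _ (by omega)) (g (i + 2 * j + 1)) (hg _ (by omega))
      (g (i + 2 * (j + 1))) (hg _ h)
      (hmono (mem_Iio.2 (by omega)) (mem_Iio.2 (by omega)) (by omega))
      (hmono (mem_Iio.2 (by omega)) (mem_Iio.2 (by omega)) (by omega))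
    push_cast
    linarith

/-- With `2 * m + 2` points, the one of index `2 * m` has already reached `b`, leaving no room for
the next. -/
theorem encard_le_of_gap (hT : T ⊆ Icc a b) (hab : b - a = 2 * L * m)
    (hgap : ∀ x ∈ T, ∀ y ∈ T, ∀ z ∈ T, x < y → y < z → 2 * L ≤ z - x) :
    T.encard ≤ ((2 * m + 1 : ℕ) : ℕ∞) := by
  by_contra! hlt
  have hle : ((2 * m + 1 + 1 : ℕ) : ℕ∞) ≤ T.encard := by
    rw [Nat.cast_add_one]
    exact Order.add_one_le_of_lt hlt
  obtain ⟨g, hg, hmono⟩ := exists_strictMonoOn_of_le_encard hle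
  have h1 := add_two_mul_le_of_gap hgap hg hmono 0 m (by omega)
  have h2 := hmono (mem_Iio.2 (by omega)) (mem_Iio.2 (by omega)) (show 2 * m < 2 * m + 1 by omega)
  have h3 := (hT (hg 0 (by omega))).1
  have h4 := (hT (hg (2 * m + 1) (by omega))).2
  rw [zero_add] at h1
  linarith

/-- Already `2 * m + 1` points would push the last one to `b`, which the half-open interval omits.
-/
theorem encard_lt_of_gap (hT : T ⊆ Ico a b) (hab : b - a = 2 * L * m)
    (hgap : ∀ x ∈ T, ∀ y ∈ T, ∀ z ∈ T, x < y → y < z → 2 * L ≤ z - x) :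
    T.encard < ((2 * m + 1 : ℕ) : ℕ∞) := by
  by_contra! hle
  obtain ⟨g, hg, hmono⟩ := exists_strictMonoOn_of_le_encard hle
  have h1 := add_two_mul_le_of_gap hgap hg hmono 0 m (by omega)
  have h3 := (hT (hg 0 (by omega))).1
  have h4 := (hT (hg (2 * m) (by omega))).2
  rw [zero_add] at h1
  linarith

theorem encard_arithmetic_progression (hL : 0 < L) :
    {s : ℝ | ∃ i : ℕ, i < n ∧ s = a + i * L}.encard = n := by
  have h1 : {s : ℝ | ∃ i : ℕ, i < n ∧ s = a + i * L} = (fun i : ℕ => a + i * L) '' Iio n := by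
    ext s
    simp only [mem_ofPred_eq, mem_image, mem_Iio, eq_comm]
  have hinj : Function.Injective (fun i : ℕ => a + i * L) := by
    intro i j h
    simp only [add_right_inj] at h
    exact_mod_cast mul_right_cancel₀ hL.ne' h
  rw [h1, hinj.encard_image, encard_eq_coe_toFinset_card]
  simp

theorem eq_arithmetic_progression_of_gap (hL : 0 < L) (hT : T ⊆ Icc a b) (hab : b - a = 2 * L * m)
    (hgap : ∀ x ∈ T, ∀ y ∈ T, ∀ z ∈ T, x < y → y < z → 2 * L ≤ z - x)
    (hmid : ∀ x ∈ T, ∀ y ∈ T, ∀ z ∈ T, x < y → y < z → z - x = 2 * L → y = x + L)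
    (hcard : T.encard = ((2 * m + 1 : ℕ) : ℕ∞)) :
    T = {s : ℝ | ∃ i : ℕ, i < 2 * m + 1 ∧ s = a + i * L} := by
  obtain ⟨g, hg, hmono⟩ := exists_strictMonoOn_of_le_encard hcard.ge
  -- The gaps counted from `a` bound `g (2 * j)` below, and those counted back from `b` bound it
  -- above by the same value.
  have heven : ∀ j ≤ m, g (2 * j) = a + 2 * L * j := by
    intro j hj
    have h1 := add_two_mul_le_of_gap hgap hg hmono 0 j (by omega)
    have h2 := add_two_mul_le_of_gap hgap hg hmono (2 * j) (m - j) (by omega)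
    rw [zero_add] at h1
    rw [show 2 * j + 2 * (m - j) = 2 * m by omega, Nat.cast_sub hj] at h2
    have h3 := (hT (hg 0 (by omega))).1
    have h4 := (hT (hg (2 * m) (by omega))).2
    linarith
  refine ((finite_of_encard_eq_coe hcard).eq_of_subset_of_encard_le' ?_ ?_).symm
  · rintro s ⟨i, hi, rfl⟩
    obtain ⟨j, rfl | rfl⟩ := i.even_or_odd'
    · have := heven j (by omega)
      have h1 := hg (2 * j) hi
      rw [this] at h1
      convert h1 using 1
      push_cast
      ring
    · have h0 := heven j (by omega)
      have h2 := heven (j + 1) (by omega)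
      have := hmid (g (2 * j)) (hg _ (by omega)) (g (2 * j + 1)) (hg _ hi) (g (2 * (j + 1)))
        (hg _ (by omega)) (hmono (mem_Iio.2 (by omega)) (mem_Iio.2 (by omega)) (by omega))
        (hmono (mem_Iio.2 (by omega)) (mem_Iio.2 (by omega)) (by omega))
        (by rw [h0, h2]; push_cast; ring)
      have h1 := hg (2 * j + 1) hi
      rw [this, h0] at h1
      convert h1 using 1
      push_cast
      ring
  · rw [hcard, encard_arithmetic_progression hL]

end Gap

/-! ### Closed curves of constant affine curvature -/

theorem exists_sin_cos_eq {x y : ℝ} (h : x ^ 2 + y ^ 2 = 1) :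
    ∃ θ ∈ Icc 0 (2 * π), sin θ = x ∧ cos θ = y := by
  have hz : ‖(⟨y, x⟩ : ℂ)‖ = 1 := by
    rw [Complex.norm_def, Complex.normSq_mk, Real.sqrt_eq_one]
    linarith
  have hz0 : (⟨y, x⟩ : ℂ) ≠ 0 := by
    intro h0
    rw [h0, norm_zero] at hz
    exact zero_ne_one hz
  have hs : sin (Complex.arg ⟨y, x⟩) = x := by rw [Complex.sin_arg, hz, div_one]
  have hc : cos (Complex.arg ⟨y, x⟩) = y := by rw [Complex.cos_arg hz0, hz, div_one]
  have h1 := Complex.neg_pi_lt_arg (⟨y, x⟩ : ℂ)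
  have h2 := Complex.arg_le_pi (⟨y, x⟩ : ℂ)
  rcases le_or_gt 0 (Complex.arg ⟨y, x⟩) with h0 | h0
  · exact ⟨_, ⟨h0, by linarith [Real.pi_pos]⟩, hs, hc⟩
  · exact ⟨Complex.arg ⟨y, x⟩ + 2 * π, ⟨by linarith, by linarith⟩,
      by rw [Real.sin_add_two_pi, hs], by rw [Real.cos_add_two_pi, hc]⟩

/-- An ellipse is the boundary of a bounded convex domain. -/
theorem isClosedConvexCurve_ellipse (p u w : Plane) (huw : wedge u w ≠ 0) :
    IsClosedConvexCurve {q : Plane | ∃ x y : ℝ, x ^ 2 + y ^ 2 = 1 ∧ q = p + (x • u + y • w)} := by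
  let A : Plane →ₗ[ℝ] Plane :=
    { toFun := fun q => q 0 • u + q 1 • w
      map_add' := fun q r => by simp only [PiLp.add_apply]; module
      map_smul' := fun t q => by
        simp only [PiLp.smul_apply, smul_eq_mul, RingHom.id_apply]; module }
  have hA : Function.Injective A := by
    rw [injective_iff_map_eq_zero]
    intro q hq
    have h0 : q 0 * u 0 + q 1 * w 0 = 0 := by
      simpa [A] using congrArg (fun r : Plane => r 0) hq
    have h1 : q 0 * u 1 + q 1 * w 1 = 0 := by
      simpa [A] using congrArg (fun r : Plane => r 1) hq
    have e0 : q 0 * wedge u w = 0 := by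
      simp only [wedge]; linear_combination w 1 * h0 - w 0 * h1
    have e1 : q 1 * wedge u w = 0 := by
      simp only [wedge]; linear_combination u 0 * h1 - u 1 * h0
    ext i
    fin_cases i
    · simpa [huw] using e0
    · simpa [huw] using e1
  let e := (LinearEquiv.ofInjectiveEndo A hA).toContinuousLinearEquiv
  have he : ∀ q, e q = q 0 • u + q 1 • w := fun q => rfl
  let h : Plane ≃ₜ Plane := e.toHomeomorph.trans (Homeomorph.addLeft p)
  have hh : ∀ q, h q = p + (q 0 • u + q 1 • w) := fun q => rfl
  have himg : h '' Metric.ball 0 1 = (fun q => p + q) '' (e '' Metric.ball 0 1) := by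
    rw [image_image]; rfl
  refine ⟨h '' Metric.ball 0 1, h.isOpen_image.2 Metric.isOpen_ball, ?_, ?_, ?_⟩
  · rw [himg]
    exact ((convex_ball (0 : Plane) 1).is_linear_image e.toLinearMap.isLinear).translate p
  · have : IsCompact (h '' Metric.closedBall 0 1) :=
      (isCompact_closedBall (0 : Plane) 1).image h.continuous
    exact this.isBounded.subset (image_mono Metric.ball_subset_closedBall)
  · rw [← h.image_frontier, frontier_ball (0 : Plane) one_ne_zero]
    ext q
    simp only [mem_ofPred_eq, mem_image, mem_sphere_iff_norm, sub_zero, hh]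
    constructor
    · rintro ⟨x, y, hxy, rfl⟩
      refine ⟨!₂[x, y], ?_, by simp⟩
      rw [EuclideanSpace.norm_eq, Real.sqrt_eq_one]
      simpa using hxy
    · rintro ⟨r, hr, rfl⟩
      refine ⟨r 0, r 1, ?_, rfl⟩
      rw [EuclideanSpace.norm_eq, Real.sqrt_eq_one] at hr
      simpa using hr

theorem eq_of_forall_wedge_eq {p q : Plane} (h : ∀ v, wedge v p = wedge v q) : p = q := by
  have h0 := h !₂[1, 0]
  have h1 := h !₂[0, 1]
  simp [wedge] at h0 h1
  ext i
  fin_cases i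
  · exact h1
  · exact h0

namespace IsEmbeddedConvexCurve

variable {c : ℝ → Plane} {a b k : ℝ}

/-- Curves of constant affine curvature are conics. -/
theorem eq_conic (hC : IsEmbeddedConvexCurve c a b)
    (hκ : ∀ s ∈ Icc a b, affineCurvature c a b s = k) {t : ℝ} (ht : t ∈ Icc a b) :
    c t = c a + sinK k (t - a) • curveDeriv 1 c a b a + yBar k (t - a) • curveDeriv 2 c a b a := by
  refine eq_of_forall_wedge_eq fun v => ?_
  -- Variation of constants for `u''' + k u' = 0`: the expression is constant in `r`, equal to `v ∧
  -- c(t)` at `r = t` and to the wedge of `v` with the conic formula at `r = a`.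
  have hd : ∀ r ∈ Icc a b, HasDerivWithinAt (fun r => wedge v (c r)
      + wedge v (curveDeriv 1 c a b r) * sinK k (t - r)
      + wedge v (curveDeriv 2 c a b r) * yBar k (t - r)) 0 (Icc a b) r := by
    intro r hr
    have h0 := (hC.hasDerivWithinAt_zero hr).wedge_right v
    have h1 := (hC.hasDerivWithinAt_one hr).wedge_right v
    have h2 := (hC.hasDerivWithinAt_two hr).wedge_right v
    have hs : HasDerivWithinAt (fun r => t - r) (-1) (Icc a b) r :=
      (hasDerivWithinAt_id r _).const_sub t
    have h3 := (hasDerivAt_sinK k (t - r)).comp_hasDerivWithinAt r hs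
    have h4 := (hasDerivAt_yBar k (t - r)).comp_hasDerivWithinAt r hs
    refine ((h0.add (h1.mul h3)).add (h2.mul h4)).congr_deriv ?_
    rw [wedge_smul_right, hκ r hr]
    simp only [Function.comp]
    linear_combination wedge v (curveDeriv 1 c a b r) * one_sub_cosK k (t - r)
  have hsub : Icc a t ⊆ Icc a b := Icc_subset_Icc le_rfl ht.2
  have h1 := le_of_hasDerivWithinAt_nonneg ht.1 (fun r hr => (hd r (hsub hr)).mono hsub)
    fun _ _ => le_rfl
  have h2 := le_of_hasDerivWithinAt_nonneg ht.1 (fun r hr => (hd r (hsub hr)).mono hsub |>.neg)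
    fun _ _ => neg_zero.ge
  simp only [Pi.neg_apply, sub_self, sinK_zero, yBar_zero, mul_zero, add_zero] at h1 h2
  have h3 : wedge v (c a + sinK k (t - a) • curveDeriv 1 c a b a
      + yBar k (t - a) • curveDeriv 2 c a b a) = wedge v (c a)
      + wedge v (curveDeriv 1 c a b a) * sinK k (t - a)
      + wedge v (curveDeriv 2 c a b a) * yBar k (t - a) := by
    simp only [wedge, PiLp.add_apply, PiLp.smul_apply, smul_eq_mul]; ring
  rw [h3]
  linarith

/-- Comparison with `K = 0` has no length restriction, so `c'(a) ∧ (c b - c a) > 0`. -/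
theorem ne_of_nonpos (hC : IsEmbeddedConvexCurve c a b) (hk : k ≤ 0)
    (hκ : ∀ s ∈ Icc a b, affineCurvature c a b s = k) : c a ≠ c b := by
  intro heq
  have hlt := hC.lt
  have h := hC.wedge_curveDeriv_one_sub_pos (L := b - a) (K := 0) (s := a) (x := a) (y := b)
    (by rw [modelI, if_pos le_rfl]; exact sub_nonneg.2 hlt.le) (fun s hs => (hκ s hs).trans_le hk)
    (left_mem_Icc.2 hlt.le) (right_mem_Icc.2 hlt.le) le_rfl hlt (by linarith)
  rw [heq, sub_self] at h
  simp [wedge] at h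

/-- Closing up forces `k > 0`, so the conic is an ellipse traced with angle `√k * (t - a)`.
Returning to the starting point makes the total angle a positive multiple of `2 * π`, hence the
whole ellipse is covered. -/
theorem isClosedConvexCurve_of_affineCurvature_eq (hC : IsEmbeddedConvexCurve c a b)
    (hκ : ∀ s ∈ Icc a b, affineCurvature c a b s = k) (hab : c a = c b) :
    IsClosedConvexCurve (c '' Icc a b) := by
  have hlt := hC.lt
  have hk : 0 < k := by
    by_contra! hk
    exact hC.ne_of_nonpos hk hκ hab
  have hω := Real.sqrt_pos.2 hk
  have hω2 := Real.sq_sqrt hk.le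
  set ω := √k with hωdef
  have hunit := hC.unit_speed a (left_mem_Icc.2 hlt.le)
  set u := curveDeriv 1 c a b a with hu
  set w := curveDeriv 2 c a b a with hw
  have hcon : ∀ t ∈ Icc a b, c t = (c a + k⁻¹ • w)
      + (sin (ω * (t - a)) • (ω⁻¹ • u) + cos (ω * (t - a)) • (-k⁻¹ • w)) := by
    intro t ht
    rw [hC.eq_conic hκ ht, sinK, yBar, cosK, if_pos hk, if_pos hk, if_neg hk.ne', div_eq_mul_inv,
      div_eq_mul_inv, ← hωdef, ← hu, ← hw]
    module
  have hper : 2 * π ≤ ω * (b - a) := by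
    have h1 := hC.eq_conic hκ (right_mem_Icc.2 hlt.le)
    rw [hab, add_assoc] at h1
    have h2 := left_eq_add.1 h1
    have h3 : yBar k (b - a) = 0 := by
      -- Wedging the closing relation with `u` isolates the coefficient of `w`, as `u ∧ w = 1`.
      have : wedge u (sinK k (b - a) • u + yBar k (b - a) • w) = 0 := by
        rw [h2]; simp [wedge]
      have h4 : wedge u (sinK k (b - a) • u + yBar k (b - a) • w)
          = yBar k (b - a) * wedge u w := by
        simp only [wedge, PiLp.add_apply, PiLp.smul_apply, smul_eq_mul]; ring
      rw [h4, hunit, mul_one] at this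
      exact this
    have h5 : cos (ω * (b - a)) = 1 := by
      have := one_sub_cosK k (b - a)
      rw [h3, cosK, if_pos hk] at this
      linarith
    obtain ⟨n, hn⟩ := (Real.cos_eq_one_iff _).1 h5
    have hpos : 0 < ω * (b - a) := mul_pos hω (sub_pos.2 hlt)
    rw [← hn] at hpos
    have hn1 : (0 : ℝ) < n := (pos_iff_pos_of_mul_pos hpos).2 (by positivity)
    have hn2 : (1 : ℝ) ≤ n := by exact_mod_cast (Int.cast_pos.1 hn1)
    rw [← hn]
    nlinarith [Real.pi_pos]
  have hne : wedge (ω⁻¹ • u) (-k⁻¹ • w) ≠ 0 := by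
    have : wedge (ω⁻¹ • u) (-k⁻¹ • w) = -(ω⁻¹ * k⁻¹) * wedge u w := by
      simp only [wedge, PiLp.smul_apply, smul_eq_mul]; ring
    rw [this, hunit, mul_one]
    exact neg_ne_zero.2 (mul_pos (inv_pos.2 hω) (inv_pos.2 hk)).ne'
  convert isClosedConvexCurve_ellipse (c a + k⁻¹ • w) (ω⁻¹ • u) (-k⁻¹ • w) hne using 1
  ext q
  constructor
  · rintro ⟨t, ht, rfl⟩
    exact ⟨_, _, Real.sin_sq_add_cos_sq (ω * (t - a)), hcon t ht⟩
  · rintro ⟨x, y, hxy, rfl⟩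
    obtain ⟨θ, hθ, rfl, rfl⟩ := exists_sin_cos_eq hxy
    have hθω : ω * (a + θ / ω - a) = θ := by field_simp; ring
    have hmem : a + θ / ω ∈ Icc a b := by
      have h1 : 0 ≤ θ / ω := div_nonneg hθ.1 hω.le
      have h2 : θ / ω ≤ b - a := by
        rw [div_le_iff₀ hω]
        linarith [hθ.2]
      exact ⟨by linarith, by linarith⟩
    exact ⟨a + θ / ω, hmem, by rw [hcon _ hmem, hθω]⟩

theorem affineLength_eq (hC : IsEmbeddedConvexCurve c a b) {s t : ℝ} (hs : s ∈ Icc a b)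
    (ht : t ∈ Icc a b) : affineLength c a b s t = t - s := by
  have : EqOn (fun u => (wedge (curveDeriv 1 c a b u) (curveDeriv 2 c a b u)) ^ (1 / 3 : ℝ))
      (fun _ => 1) (uIcc s t) := by
    intro u hu
    simp only [hC.unit_speed u (uIcc_subset_Icc hs ht hu), Real.one_rpow]
  rw [affineLength, intervalIntegral.integral_congr this]
  simp

end IsEmbeddedConvexCurve

theorem fundamentalArea_pos {v₁ v₂ : Plane} (hv : LinearIndependent ℝ ![v₁, v₂]) :
    0 < fundamentalArea v₁ v₂ := by
  refine abs_pos.2 fun h => ?_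
  rw [LinearIndependent.pair_iff] at hv
  simp only [wedge] at h
  have h1 := hv (v₂ 1) (-(v₁ 1)) (by
    ext i
    fin_cases i
    · simp; linarith
    · simp; ring)
  have h0 := hv (v₂ 0) (-(v₁ 0)) (by
    ext i
    fin_cases i
    · simp; ring
    · simp; linarith)
  have := hv 1 0 (by
    ext i
    fin_cases i
    · simpa using h0.2
    · simpa using h1.2)
  exact one_ne_zero this.1

/-- For this curvature `L` is exactly the right endpoint of the interval, so it is the largest upper
curvature bound the comparison allows. -/
theorem mem_modelI_pi_div_sq {L : ℝ} (hL : 0 < L) : L ∈ modelI ((π / (2 * L)) ^ 2) := by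
  have hpos : 0 < π / (2 * L) := by positivity
  rw [modelI, if_neg (not_le.2 (by positivity)), Real.sqrt_sq hpos.le]
  refine ⟨hL.le, le_of_eq ?_⟩
  field_simp

/-! ### Evenly spaced points on the curve -/

namespace IsEmbeddedConvexCurve

variable {c : ℝ → Plane} {a b L : ℝ} {S : Set Plane} {m : ℕ}

/-- If the consecutive points of a set on an arc are evenly spaced, and the initial point belongs
to the set, then so do the points at multiples of the spacing. -/
theorem progression_mem_of_evenlySpaced (hC : IsEmbeddedConvexCurve c a b) (hL : 0 < L)
    (hfin : {s | s ∈ Icc a b ∧ c s ∈ S}.Finite) (heven : EvenlySpaced c a b S L)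
    (hab : b - a = 2 * L * m) (ha : c a ∈ S) (hb : c b ∈ S) (i : ℕ) (hi : i < 2 * m + 1) :
    a + i * L ∈ Icc a b ∧ c (a + i * L) ∈ S := by
  induction i with
  | zero => simpa using ⟨hC.lt.le, ha⟩
  | succ i ih =>
    obtain ⟨hs, hsS⟩ := ih (by omega)
    set s := a + i * L with hsdef
    have hsb : s < b := by
      have : (i : ℝ) < 2 * m := by exact_mod_cast (show i < 2 * m by omega)
      nlinarith
    -- The next parameter in the set exists by finiteness, with `b` itself as a candidate; even
    -- spacing places it at `s + L`.
    obtain ⟨t, ⟨⟨htI, htS⟩, hst⟩, hmin⟩ :=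
      Set.exists_min_image ({s | s ∈ Icc a b ∧ c s ∈ S} ∩ Ioi s) id
        (hfin.subset inter_subset_left) ⟨b, ⟨right_mem_Icc.2 hC.lt.le, hb⟩, hsb⟩
    have hlen := heven s hs t htI hsS htS hst fun u hu huS =>
      absurd (hmin u ⟨⟨⟨hs.1.trans hu.1.le, hu.2.le.trans htI.2⟩, huS⟩, hu.1⟩) (not_le.2 hu.2)
    rw [hC.affineLength_eq hs htI] at hlen
    have : a + ((i + 1 : ℕ) : ℝ) * L = t := by push_cast; linarith
    rw [this]
    exact ⟨htI, htS⟩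

theorem evenlySpaced_of_eq_progression (hC : IsEmbeddedConvexCurve c a b) (hL : 0 < L) {n : ℕ}
    (hT : {s | s ∈ Icc a b ∧ c s ∈ S} = {s : ℝ | ∃ i : ℕ, i < n ∧ s = a + i * L}) :
    EvenlySpaced c a b S L := by
  intro s hs t ht hsS htS hst hno
  obtain ⟨i, hi, rfl⟩ := hT.subset ⟨hs, hsS⟩
  obtain ⟨j, hj, rfl⟩ := hT.subset ⟨ht, htS⟩
  have hij : i < j := by
    have : (i : ℝ) < j := lt_of_mul_lt_mul_right (by linarith) hL.le
    exact_mod_cast this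
  have hji : j = i + 1 := by
    by_contra hne
    have hlt : ((i + 1 : ℕ) : ℝ) < j := by exact_mod_cast (show i + 1 < j by omega)
    have hmem : a + ((i + 1 : ℕ) : ℝ) * L ∈ {s | s ∈ Icc a b ∧ c s ∈ S} :=
      hT.superset ⟨i + 1, by omega, rfl⟩
    refine hno _ ⟨?_, ?_⟩ hmem.2
    · push_cast; linarith
    · nlinarith
  rw [hC.affineLength_eq hs ht, hji]
  push_cast
  ring

end IsEmbeddedConvexCurve

theorem theorem5
    -- the convex curve, with affine curvature between the constants k₀ and k₁
    (c : ℝ → Plane) (a b : ℝ) (hC : IsEmbeddedConvexCurve c a b)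
    (k₀ k₁ : ℝ)
    (hκ : ∀ s ∈ Icc a b, k₀ ≤ affineCurvature c a b s ∧ affineCurvature c a b s ≤ k₁)
    -- the lattice
    (v₀ v₁ v₂ : Plane) (hv : LinearIndependent ℝ ![v₁, v₂])
    -- the integer attached to the curve and the lattice
    (𝔪 : ℕ)
    (h𝔪 : IsTriangleIndex (planeLattice v₀ v₁ v₂ ∩ c '' Icc a b) (fundamentalArea v₁ v₂) 𝔪)
    -- the length L, which is defined as soon as its argument is in the domain of G
    (hJ : (𝔪 : ℝ) * fundamentalArea v₁ v₂ / 2 ∈ modelJ k₀)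
    (L : ℝ) (hL : L = modelG k₀ ((𝔪 : ℝ) * fundamentalArea v₁ v₂ / 2))
    (hk₁ : 0 < k₁ → k₁ ≤ (π / (2 * L)) ^ 2)
    -- the affine length of the curve is an integral multiple of 2L
    (m : ℕ) (hm : (m : ℝ) = affineLength c a b a b / (2 * L))
    -- the curve is not closed
    (hopen : ¬ IsClosedConvexCurve (c '' Icc a b)) :
    (planeLattice v₀ v₁ v₂ ∩ c '' Icc a b).encard ≤ ((2 * m + 1 : ℕ) : ℕ∞) ∧
    ((planeLattice v₀ v₁ v₂ ∩ c '' Icc a b).encard = ((2 * m + 1 : ℕ) : ℕ∞) ↔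
      (∀ s ∈ Icc a b, affineCurvature c a b s = k₀) ∧
      EvenlySpaced c a b (planeLattice v₀ v₁ v₂) L ∧
      c a ∈ planeLattice v₀ v₁ v₂ ∧ c b ∈ planeLattice v₀ v₁ v₂) := by
  set A := fundamentalArea v₁ v₂ with hA
  set Λ := planeLattice v₀ v₁ v₂ with hΛ
  have hApos : 0 < A := fundamentalArea_pos hv
  obtain ⟨⟨h𝔪pos, htri⟩, -⟩ := h𝔪
  have hv0 : 0 < (𝔪 : ℝ) * A / 2 := by
    have : (0 : ℝ) < 𝔪 := by exact_mod_cast h𝔪pos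
    positivity
  have hLI : L ∈ modelI k₀ := hL ▸ modelG_mem hJ
  have hLH : modelH k₀ L = (𝔪 : ℝ) * A / 2 := hL ▸ modelH_modelG hJ
  have hLpos : 0 < L := hL ▸ modelG_pos hJ hv0
  have hKI := mem_modelI_pi_div_sq hLpos
  -- Replacing `k₁` by `(π / (2 * L)) ^ 2` treats both signs of `k₁` at once.
  have hκ' : ∀ s ∈ Icc a b, k₀ ≤ affineCurvature c a b s ∧
      affineCurvature c a b s ≤ (π / (2 * L)) ^ 2 := by
    refine fun s hs => ⟨(hκ s hs).1, (hκ s hs).2.trans ?_⟩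
    rcases le_or_gt k₁ 0 with h | h
    · exact h.trans (sq_nonneg _)
    · exact hk₁ h
  have hlt := hC.lt
  have haI : a ∈ Icc a b := left_mem_Icc.2 hlt.le
  have hbI : b ∈ Icc a b := right_mem_Icc.2 hlt.le
  have hab : b - a = 2 * L * m := by
    rw [hC.affineLength_eq haI hbI] at hm
    rw [hm]
    field_simp
  have hgap : ∀ T : Set ℝ, T ⊆ {s | s ∈ Icc a b ∧ c s ∈ Λ} → InjOn c T →
      ∀ x ∈ T, ∀ y ∈ T, ∀ z ∈ T, x < y → y < z → 2 * L ≤ z - x ∧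
        (z - x = 2 * L → y = x + L ∧ ∀ r ∈ Icc x z, affineCurvature c a b r = k₀) := by
    intro T hT hinj x hx y hy z hz hxy hyz
    have hmem : ∀ s ∈ T, c s ∈ Λ ∩ c '' Icc a b := fun s hs => ⟨(hT hs).2, s, (hT hs).1, rfl⟩
    refine hC.two_mul_le_of_modelH_le hLI hKI hκ' (hT hx).1 (hT hz).1 hxy hyz ?_
    have := htri _ (hmem x hx) _ (hmem y hy) _ (hmem z hz) (hinj.ne hx hy hxy.ne)
      (hinj.ne hx hz (hxy.trans hyz).ne) (hinj.ne hy hz hyz.ne)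
    linarith
  rcases hC.embedded with hinj | ⟨hinj, hclosed⟩
  · set T := {s | s ∈ Icc a b ∧ c s ∈ Λ} with hT
    have hTI : T ⊆ Icc a b := fun s hs => hs.1
    have hinjT : InjOn c T := hinj.mono hTI
    have himg : Λ ∩ c '' Icc a b = c '' T := by
      ext q
      constructor
      · rintro ⟨hq, s, hs, rfl⟩
        exact ⟨s, ⟨hs, hq⟩, rfl⟩
      · rintro ⟨s, hs, rfl⟩
        exact ⟨hs.2, s, hs.1, rfl⟩
    have hgapT := hgap T Subset.rfl hinjT
    have hgap1 : ∀ x ∈ T, ∀ y ∈ T, ∀ z ∈ T, x < y → y < z → 2 * L ≤ z - x :=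
      fun x hx y hy z hz hxy hyz => (hgapT x hx y hy z hz hxy hyz).1
    have hle := encard_le_of_gap hTI hab hgap1
    rw [himg, hinjT.encard_image]
    refine ⟨hle, fun heq => ?_, fun ⟨_, heven, ha, hb⟩ => le_antisymm hle ?_⟩
    · have hprog := eq_arithmetic_progression_of_gap hLpos hTI hab hgap1
        (fun x hx y hy z hz hxy hyz h => ((hgapT x hx y hy z hz hxy hyz).2 h).1) heq
      have hmem : ∀ i : ℕ, i < 2 * m + 1 → a + i * L ∈ T := fun i hi => hprog.superset ⟨i, hi, rfl⟩
      refine ⟨fun s hs => ?_, hC.evenlySpaced_of_eq_progression hLpos hprog, ?_, ?_⟩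
      -- The blocks of length `2 * L` cover the curve, and each is spanned by an extremal triangle,
      -- on which `κ = k₀`. The index is the floor of `(s - a) / (2 * L)`, except at `s = b`, where
      -- it is `m - 1`.
      · obtain ⟨j, hj, hj1, hj2⟩ : ∃ j < m, a + 2 * L * j ≤ s ∧ s ≤ a + 2 * L * (j + 1) := by
          have hm0 : 0 < m := by
            rcases Nat.eq_zero_or_pos m with h | h
            · rw [h] at hab
              simp only [Nat.cast_zero, mul_zero] at hab
              linarith
            · exact h
          have hx0 : 0 ≤ (s - a) / (2 * L) := div_nonneg (by linarith [hs.1]) (by linarith)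
          have hxs : (s - a) / (2 * L) * (2 * L) = s - a := by field_simp
          by_cases hsm : ⌊(s - a) / (2 * L)⌋₊ < m
          · have h1 := Nat.floor_le hx0
            have h2 := (Nat.lt_floor_add_one ((s - a) / (2 * L))).le
            have h3 : 0 ≤ 2 * L := by linarith
            refine ⟨_, hsm, ?_, ?_⟩
            · linarith [mul_le_mul_of_nonneg_right h1 h3]
            · linarith [mul_le_mul_of_nonneg_right h2 h3]
          · have h1 : (m : ℝ) ≤ (s - a) / (2 * L) := (Nat.le_floor_iff hx0).1 (not_lt.1 hsm)
            rw [le_div_iff₀ (by linarith)] at h1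
            have hsb : s = b := le_antisymm hs.2 (by linarith)
            refine ⟨m - 1, by omega, ?_, ?_⟩ <;> rw [Nat.cast_pred hm0]
            · linarith
            · linarith
        have h0 := hmem (2 * j) (by omega)
        have h1 := hmem (2 * j + 1) (by omega)
        have h2 := hmem (2 * j + 2) (by omega)
        push_cast at h0 h1 h2
        exact ((hgapT _ h0 _ h1 _ h2 (by linarith) (by linarith)).2 (by ring)).2 s
          ⟨by linarith, by linarith⟩
      · simpa using (hmem 0 (by omega)).2
      · have h1 := (hmem (2 * m) (by omega)).2
        rwa [show a + ((2 * m : ℕ) : ℝ) * L = b by push_cast; linarith] at h1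
    · rw [← encard_arithmetic_progression (a := a) (n := 2 * m + 1) hLpos]
      refine encard_le_encard ?_
      rintro s ⟨i, hi, rfl⟩
      exact hC.progression_mem_of_evenlySpaced hLpos (finite_of_encard_le_coe hle) heven hab ha hb
        i hi
  · have hcab : c a = c b := by
      have := hclosed 0 (by norm_num)
      simpa [curveDeriv] using this
    -- Dropping `b` counts the common endpoint once and keeps `c` injective on `T`.
    set T := {s | s ∈ Ico a b ∧ c s ∈ Λ} with hT
    have hTI : T ⊆ Ico a b := fun s hs => hs.1
    have hinjT : InjOn c T := hinj.mono hTI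
    have himg : Λ ∩ c '' Icc a b = c '' T := by
      ext q
      constructor
      · rintro ⟨hq, s, hs, rfl⟩
        rcases hs.2.eq_or_lt with h | h
        · exact ⟨a, ⟨left_mem_Ico.2 hlt, by rwa [hcab, ← h]⟩, by rw [hcab, h]⟩
        · exact ⟨s, ⟨⟨hs.1, h⟩, hq⟩, rfl⟩
      · rintro ⟨s, hs, rfl⟩
        exact ⟨hs.2, s, Ico_subset_Icc_self hs.1, rfl⟩
    have hgapT := hgap T (fun s hs => ⟨Ico_subset_Icc_self hs.1, hs.2⟩) hinjT
    have hcard := encard_lt_of_gap hTI hab fun x hx y hy z hz hxy hyz =>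
      (hgapT x hx y hy z hz hxy hyz).1
    rw [himg, hinjT.encard_image]
    -- Both sides of the equivalence are false: the count is strictly smaller, and constant
    -- curvature would make the curve a full ellipse.
    exact ⟨hcard.le, fun heq => absurd heq hcard.ne, fun ⟨hk, _⟩ =>
      absurd (hC.isClosedConvexCurve_of_affineCurvature_eq hk hcab) hopen⟩
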